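/- Let $m\ge 3$ be odd, let $q=3^m$ and $n=q-1$, and let $\alpha$ be a generator of the multiplicative group $\mathrm{GF}(q)^*$. For an integer $a\ge 0$ let $\mathtt{C}_a=\{a\,3^j \bmod n : j\ge 0\}$ be the $3$-cyclotomic coset of $a$ modulo $n$ and let $\ell_a=|\mathtt{C}_a|$. For integers $u,v\ge 0$ let $\mathcal{C}_{(u,v,3,m)}\subseteq \mathrm{GF}(3)^n$ be the set of the words $\mathbf{c}(a,b)=(c_0,\dots,c_{n-1})$, $$c_i=\mathrm{Tr}_1^{\ell_u}(a\alpha^{iu})+\mathrm{Tr}_1^{\ell_v}(b\alpha^{iv}),\qquad 0\le i\le n-1,$$ with $(a,b)\in \mathrm{GF}(3^{\ell_u})\times\mathrm{GF}(3^{\ell_v})$, where $\mathrm{Tr}_1^{\ell}$ denotes the trace from $\mathrm{GF}(3^\ell)$ to $\mathrm{GF}(3)$. (The code depends only on $u$ and $v$ modulo $n$.) Suppose that one of the following holds: 1. $v=\dfrac{3^{m+1}-1}{3^h+1}+\dfrac{3^m-1}{2}$, where $h$ is a positive integer dividing $m+1$ such that $(m+1)/h$ is even; 2. $v=(3^{(m+1)/8}-1)(3^{(m+1)/4}+1)(3^{(m+1)/2}+1)+\dfrac{3^m-1}{2}$,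 where $m\equiv 7\pmod 8$; 3. $v=(3^{(m+1)/4}-1)(3^{(m+1)/2}+1)+\dfrac{3^m-1}{2}$, where $m\equiv 3\pmod 4$. Then $\mathtt{C}_1\cap\mathtt{C}_v=\emptyset$, $\ell_1=\ell_v=m$, and $\mathcal{C}_{(1,v,3,m)}$ is a cyclic code over $\mathrm{GF}(3)$ of length $3^m-1$ and dimension $2m$. The number $A_w$ of its codewords of Hamming weight $w$ is - $A_0=1$, - $A_w=\frac12(3^m-1)\left(3^{m-1}+3^{(m-1)/2}\right)$ for $w=2\left(3^{m-1}-3^{(m-1)/2}\right)$, - $A_w=(3^m-1)\left(3^m-3^{m-1}+1\right)$ for $w=2\cdot 3^{m-1}$, - $A_w=\frac12(3^m-1)\left(3^{m-1}-3^{(m-1)/2}\right)$ for $w=2\left(3^{m-1}+3^{(m-1)/2}\right)$, and $A_w=0$ for every other $w$. -/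

import Mathlib

open scoped IntermediateField

/-- The `p`-cyclotomic coset modulo `n` containing `a`, as a set of residue classes modulo `n`. -/
def cyclotomicCoset (p n a : ℕ) : Set (ZMod n) :=
  {x | ∃ j : ℕ, x = (a : ZMod n) * (p : ZMod n) ^ j}

/-- The linear map sending `(a, b)` to the word `(c_0, …, c_{n-1})`, `n = p ^ m - 1`, with
`c_i = Tr (a α^{iu}) + Tr (b α^{iv})`. Here `a` and the powers of `α^u` lie in the subfield
`GF(p)(α^u)` of `K`, which is the field with `p ^ ℓ_u` elements, `ℓ_u` being the size of the
`p`-cyclotomic coset of `u` (proved in `finrank_adjoin_pow` below), and the trace is the one from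
that subfield to `GF(p)`; likewise for `b` and `v`. -/
noncomputable def codewordMap (u v p m : ℕ) [Fact p.Prime] {K : Type*} [Field K]
    [Algebra (ZMod p) K] (α : Kˣ) :
    ((ZMod p)⟮(α : K) ^ u⟯ × (ZMod p)⟮(α : K) ^ v⟯) →ₗ[ZMod p] (Fin (p ^ m - 1) → ZMod p) :=
  LinearMap.pi fun i =>
    LinearMap.coprod
      (Algebra.trace (ZMod p) (ZMod p)⟮(α : K) ^ u⟯ ∘ₗ
        LinearMap.mulRight (ZMod p)
          (IntermediateField.AdjoinSimple.gen (ZMod p) ((α : K) ^ u) ^ (i : ℕ)))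
      (Algebra.trace (ZMod p) (ZMod p)⟮(α : K) ^ v⟯ ∘ₗ
        LinearMap.mulRight (ZMod p)
          (IntermediateField.AdjoinSimple.gen (ZMod p) ((α : K) ^ v) ^ (i : ℕ)))

/-- The code `C_(u,v,p,m)` of length `p ^ m - 1` over `GF(p)`, for a generator `α` of the
multiplicative group of a field `K` with `p ^ m` elements. -/
noncomputable def cyclicCode (u v p m : ℕ) [Fact p.Prime] {K : Type*} [Field K]
    [Algebra (ZMod p) K] (α : Kˣ) : Submodule (ZMod p) (Fin (p ^ m - 1) → ZMod p) :=
  LinearMap.range (codewordMap u v p m α)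

/-- A linear code is cyclic if `(c_{n-1}, c_0, …, c_{n-2})` is a codeword whenever
`(c_0, c_1, …, c_{n-1})` is one. -/
def IsCyclicCode {F : Type*} [Field F] {n : ℕ} (C : Submodule F (Fin n → F)) : Prop :=
  ∀ c ∈ C, (fun i => c ((finRotate n).symm i)) ∈ C

/-- The number `A_w` of codewords of Hamming weight `w`. -/
noncomputable def weightCount {F : Type*} [Field F] [DecidableEq F] {n : ℕ}
    (C : Submodule F (Fin n → F)) (w : ℕ) : ℕ :=
  Set.ncard {c : Fin n → F | c ∈ C ∧ hammingNorm c = w}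

/-- The subfield `GF(p)(α^u)` has degree `ℓ_u`, the size of the cyclotomic coset of `u`. -/
theorem finrank_adjoin_pow (p m u : ℕ) [Fact p.Prime] {K : Type*} [Field K]
    [Algebra (ZMod p) K] (hK : Nat.card K = p ^ m) (hm : 0 < m) (α : Kˣ)
    (hα : ∀ x : Kˣ, x ∈ Subgroup.zpowers α) :
    Module.finrank (ZMod p) (ZMod p)⟮(α : K) ^ u⟯ = (cyclotomicCoset p (p ^ m - 1) u).ncard := by
  classical
  have hp : p.Prime := Fact.out
  have hn : 0 < p ^ m - 1 := Nat.sub_pos_of_lt (Nat.one_lt_pow hm.ne' hp.one_lt)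
  have : NeZero (p ^ m - 1) := ⟨hn.ne'⟩
  have : Finite K := Nat.finite_of_card_ne_zero (by rw [hK]; exact (pow_pos hp.pos m).ne')
  have : Fintype K := Fintype.ofFinite K
  have : Module.Finite (ZMod p) K := Module.Finite.of_finite
  have hord : orderOf α = p ^ m - 1 := by
    rw [orderOf_eq_card_of_forall_mem_zpowers hα, Nat.card_units, hK]
  have hpow : ∀ a b : ℕ, (α : K) ^ a = (α : K) ^ b ↔
      ((a : ZMod (p ^ m - 1)) = (b : ZMod (p ^ m - 1))) := by
    intro a b
    rw [ZMod.natCast_eq_natCast_iff, ← hord, ← pow_eq_pow_iff_modEq, Units.ext_iff]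
    simp
  set β : K := (α : K) ^ u with hβ
  have hint : IsIntegral (ZMod p) β := Algebra.IsIntegral.isIntegral β
  have hinj : Function.Injective (fun x : ZMod (p ^ m - 1) => (α : K) ^ x.val) := by
    intro x y hxy
    simpa using (hpow _ _).1 hxy
  have himg : (fun x : ZMod (p ^ m - 1) => (α : K) ^ x.val) '' cyclotomicCoset p (p ^ m - 1) u
      = (minpoly (ZMod p) β).rootSet K := by
    have key : ∀ j : ℕ, (α : K) ^ ((u : ZMod (p ^ m - 1)) * (p : ZMod (p ^ m - 1)) ^ j).val
        = β ^ p ^ j := by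
      intro j
      rw [hβ, ← pow_mul, hpow]
      simp
    have frob : ∀ j : ℕ, (FiniteField.frobeniusAlgEquivOfAlgebraic (ZMod p) K ^ j) β
        = β ^ p ^ j := by
      intro j
      rw [AlgEquiv.coe_pow, FiniteField.coe_frobeniusAlgEquivOfAlgebraic_iterate, ZMod.card]
    ext y
    rw [← isConjRoot_iff_mem_minpoly_rootSet hint,
      (⟨IsConjRoot.symm, IsConjRoot.symm⟩ : IsConjRoot (ZMod p) β y ↔ IsConjRoot (ZMod p) y β),
      isConjRoot_iff_exists_algEquiv]
    constructor
    · rintro ⟨x, ⟨j, rfl⟩, rfl⟩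
      exact ⟨FiniteField.frobeniusAlgEquivOfAlgebraic (ZMod p) K ^ j, by rw [frob, ← key]⟩
    · rintro ⟨σ, rfl⟩
      obtain ⟨j, rfl⟩ := (FiniteField.bijective_frobeniusAlgEquivOfAlgebraic_pow (ZMod p) K).2 σ
      exact ⟨_, ⟨j, rfl⟩, by simp only [frob, key]⟩
  rw [IntermediateField.adjoin.finrank hint,
    ← Polynomial.card_rootSet_eq_natDegree (K := K) (Algebra.IsSeparable.isSeparable (ZMod p) β)
      (Normal.splits inferInstance β),
    ← Set.ncard_image_of_injective _ hinj, himg, ← Nat.card_coe_set_eq, Nat.card_eq_fintype_card]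

/-!
In all three cases `v` is odd and `v (3 ^ h + 1) ≡ 2 [MOD q - 1]` for some `h` coprime to `m`. The
word `c(a, b)` has weight `2 (q - W) / 3`, where `W` is the Walsh coefficient at `(a, b)` of
`x ↦ x ^ v`. As `-1` is not a square in `GF(q)`, the maps `z ↦ ± z ^ (3 ^ h + 1)` together cover
`GF(q)` twice, which identifies `W` with the real part of the exponential sum of the quadratic form
`Tr (a z ^ (3 ^ h + 1) + b z ^ 2)`. The radical of that form consists of solutions of a second-order
equation in `z ↦ z ^ (3 ^ h)`, so the squared modulus of the sum is `3 ^ (m + r)` with `r ≤ 2`. The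
sum being an Eisenstein integer, this reads `4 W ^ 2 + 3 d ^ 2 = 4 * 3 ^ (m + r)` with `d ∈ ℤ`, and
for `m` odd a descent leaves only `W = 0` and `W = ± 3 ^ ((m + 1) / 2)`. The first two moments of
`W` then determine how often each value occurs.
-/

open scoped ComplexConjugate

theorem sq_sub_one_dvd_pow_sub_one {p h n : ℕ} (hdvd : h ∣ n) (heven : Even (n / h)) :
    (p ^ h + 1) * (p ^ h - 1) ∣ p ^ n - 1 := by
  obtain ⟨c, hc⟩ := even_iff_exists_two_mul.1 heven
  rw [← Nat.mul_div_cancel' hdvd, hc, pow_mul, pow_mul, ← Nat.sq_sub_sq, one_pow]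
  simpa only [one_pow] using Nat.sub_dvd_pow_sub_pow ((p ^ h) ^ 2) 1 c

theorem even_pow_sub_one_div_pow_add_one {p h n : ℕ} (hp : Odd p) (hdvd : h ∣ n)
    (heven : Even (n / h)) : Even ((p ^ n - 1) / (p ^ h + 1)) := by
  obtain ⟨t, ht⟩ := sq_sub_one_dvd_pow_sub_one (p := p) hdvd heven
  rw [ht, mul_assoc, Nat.mul_div_cancel_left _ (Nat.succ_pos _)]
  exact (Nat.Odd.sub_odd hp.pow odd_one).mul_right t

theorem pow_mod_four_of_odd {p m : ℕ} (hp : p % 4 = 3) (hm : Odd m) : p ^ m % 4 = 3 := by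
  obtain ⟨t, rfl⟩ := hm
  rw [pow_succ, pow_mul, Nat.mul_mod, Nat.pow_mod, Nat.pow_mod p, hp]
  norm_num

theorem odd_pow_sub_one_div_two {p m : ℕ} (hp : p % 4 = 3) (hm : Odd m) :
    Odd ((p ^ m - 1) / 2) := by
  have hmod := pow_mod_four_of_odd hp hm
  rw [Nat.odd_iff]
  lia

theorem add_pow_sub_one_half_mul_modEq {p m h : ℕ} (hp : Odd p)
    (hdvd : p ^ h + 1 ∣ p ^ (m + 1) - 1) :
    ((p ^ (m + 1) - 1) / (p ^ h + 1) + (p ^ m - 1) / 2) * (p ^ h + 1) ≡ p - 1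
      [MOD p ^ m - 1] := by
  have hfirst : p ^ (m + 1) - 1 = (p ^ m - 1) * p + (p - 1) := by
    have := Nat.le_mul_of_pos_left p (pow_pos hp.pos m)
    rw [pow_succ, Nat.sub_mul, one_mul]
    have := hp.pos
    lia
  have hsecond : (p ^ m - 1) / 2 * (p ^ h + 1) = (p ^ m - 1) * ((p ^ h + 1) / 2) := by
    obtain ⟨a, ha⟩ := even_iff_two_dvd.1 (Nat.Odd.sub_odd (hp.pow (n := m)) odd_one)
    obtain ⟨b, hb⟩ := even_iff_two_dvd.1 ((hp.pow (n := h)).add_odd odd_one)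
    rw [ha, hb, Nat.mul_div_cancel_left _ two_pos, Nat.mul_div_cancel_left _ two_pos]
    ring
  rw [add_mul, Nat.div_mul_cancel hdvd, hfirst, hsecond, add_right_comm, ← mul_add]
  simp [Nat.ModEq]

theorem exists_coprime_odd_modEq_two {m h : ℕ} (hodd : Odd m) (hdvd : h ∣ m + 1)
    (heven : Even ((m + 1) / h)) {v : ℕ}
    (hv : v = (3 ^ (m + 1) - 1) / (3 ^ h + 1) + (3 ^ m - 1) / 2) :
    ∃ h : ℕ, h.Coprime m ∧ Odd v ∧ v * (3 ^ h + 1) ≡ 2 [MOD 3 ^ m - 1] := by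
  have h3 : Odd 3 := by decide
  subst hv
  refine ⟨h, Nat.Coprime.coprime_dvd_left hdvd (by simp),
    (even_pow_sub_one_div_pow_add_one h3 hdvd heven).add_odd
      (odd_pow_sub_one_div_two rfl hodd), ?_⟩
  exact add_pow_sub_one_half_mul_modEq h3
    (dvd_of_mul_right_dvd (sq_sub_one_dvd_pow_sub_one hdvd heven))

theorem pow_two_mul_sub_one (p k : ℕ) : p ^ (2 * k) - 1 = (p ^ k - 1) * (p ^ k + 1) := by
  rw [mul_comm 2 k, pow_mul, mul_comm, ← Nat.sq_sub_sq, one_pow]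

theorem pow_four_mul_sub_one_div (p k : ℕ) :
    (p ^ (4 * k) - 1) / (p ^ k + 1) = (p ^ k - 1) * (p ^ (2 * k) + 1) := by
  refine Nat.div_eq_of_eq_mul_left (Nat.succ_pos _) ?_
  rw [show 4 * k = 2 * (2 * k) by ring, pow_two_mul_sub_one, pow_two_mul_sub_one]
  ring

theorem pow_eight_mul_sub_one_div (p k : ℕ) :
    (p ^ (8 * k) - 1) / (p ^ k + 1) =
      (p ^ k - 1) * (p ^ (2 * k) + 1) * (p ^ (4 * k) + 1) := by
  refine Nat.div_eq_of_eq_mul_left (Nat.succ_pos _) ?_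
  rw [show 8 * k = 2 * (2 * (2 * k)) by ring, show 4 * k = 2 * (2 * k) by ring,
    pow_two_mul_sub_one, pow_two_mul_sub_one, pow_two_mul_sub_one]
  ring

-- The last two families are the first one with `h = (m + 1) / 8` and `h = (m + 1) / 4`.
theorem exists_coprime_odd_modEq_two_of_families {m : ℕ} (hodd : Odd m) {v : ℕ}
    (hv : (∃ h : ℕ, 0 < h ∧ h ∣ m + 1 ∧ Even ((m + 1) / h) ∧
            v = (3 ^ (m + 1) - 1) / (3 ^ h + 1) + (3 ^ m - 1) / 2) ∨
          (m % 8 = 7 ∧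
            v = (3 ^ ((m + 1) / 8) - 1) * (3 ^ ((m + 1) / 4) + 1) * (3 ^ ((m + 1) / 2) + 1)
                  + (3 ^ m - 1) / 2) ∨
          (m % 4 = 3 ∧
            v = (3 ^ ((m + 1) / 4) - 1) * (3 ^ ((m + 1) / 2) + 1) + (3 ^ m - 1) / 2)) :
    ∃ h : ℕ, h.Coprime m ∧ Odd v ∧ v * (3 ^ h + 1) ≡ 2 [MOD 3 ^ m - 1] := by
  rcases hv with ⟨h, -, hdvd, heven, hv⟩ | ⟨hm, hv⟩ | ⟨hm, hv⟩
  · exact exists_coprime_odd_modEq_two hodd hdvd heven hv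
  · obtain ⟨k, hk⟩ : 8 ∣ m + 1 := by lia
    refine exists_coprime_odd_modEq_two (h := k) hodd ⟨8, by lia⟩ ?_ ?_
    · rw [hk, Nat.mul_div_cancel _ (by lia : 0 < k)]
      decide
    · rw [hv, hk, pow_eight_mul_sub_one_div, show 8 * k / 8 = k by lia,
        show 8 * k / 4 = 2 * k by lia, show 8 * k / 2 = 4 * k by lia]
  · obtain ⟨k, hk⟩ : 4 ∣ m + 1 := by lia
    refine exists_coprime_odd_modEq_two (h := k) hodd ⟨4, by lia⟩ ?_ ?_
    · rw [hk, Nat.mul_div_cancel _ (by lia : 0 < k)]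
      decide
    · rw [hv, hk, pow_four_mul_sub_one_div, show 4 * k / 4 = k by lia,
        show 4 * k / 2 = 2 * k by lia]

theorem coprime_of_odd_of_mul_modEq_two {v k n : ℕ} (hv : Odd v) (h : v * k ≡ 2 [MOD n]) :
    v.Coprime n := by
  have hgcd : v.gcd n ∣ 2 :=
    (h.dvd_iff (Nat.gcd_dvd_right v n)).1 ((Nat.gcd_dvd_left v n).mul_right k)
  exact Nat.eq_one_of_dvd_coprimes (Nat.coprime_two_right.2 hv) (Nat.gcd_dvd_left v n) hgcd

theorem natCast_pow_eq_one (p m : ℕ) (hp : p ≠ 0) : (p : ZMod (p ^ m - 1)) ^ m = 1 := by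
  have h := ZMod.natCast_self (p ^ m - 1)
  rwa [Nat.cast_sub (Nat.one_le_pow _ _ (Nat.pos_of_ne_zero hp)), sub_eq_zero, Nat.cast_pow,
    Nat.cast_one] at h

theorem orderOf_natCast_zmod_pow_sub_one {p m : ℕ} (hp : 2 ≤ p) (hm : m ≠ 0) :
    orderOf (p : ZMod (p ^ m - 1)) = m := by
  refine (orderOf_eq_iff (Nat.pos_of_ne_zero hm)).2
    ⟨natCast_pow_eq_one p m (by lia), fun i him hi hpi => ?_⟩
  have hdvd : p ^ m - 1 ∣ p ^ i - 1 := by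
    rw [← (Nat.modEq_iff_dvd' (Nat.one_le_pow i p (by lia))), ← ZMod.natCast_eq_natCast_iff]
    simp [hpi]
  have hlt : p ^ i < p ^ m := Nat.pow_lt_pow_right (by lia) him
  have hone : 1 < p ^ i := Nat.one_lt_pow hi.ne' (by lia)
  have := Nat.le_of_dvd (by lia) hdvd
  lia

theorem cyclotomicCoset_eq_image_powers (p n a : ℕ) :
    cyclotomicCoset p n a = (fun x => (a : ZMod n) * x) '' Submonoid.powers (p : ZMod n) := by
  ext x
  simp [cyclotomicCoset, Submonoid.mem_powers_iff, eq_comm]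

theorem ncard_cyclotomicCoset_of_coprime {p m a : ℕ} (hp : 2 ≤ p) (hm : m ≠ 0)
    (ha : a.Coprime (p ^ m - 1)) : (cyclotomicCoset p (p ^ m - 1) a).ncard = m := by
  have hord := orderOf_natCast_zmod_pow_sub_one hp hm
  have hfin : IsOfFinOrder (p : ZMod (p ^ m - 1)) :=
    orderOf_pos_iff.1 (hord.symm ▸ Nat.pos_of_ne_zero hm)
  rw [cyclotomicCoset_eq_image_powers, Set.ncard_image_of_injective _
    ((ZMod.isUnit_iff_coprime a _).2 ha).mul_right_injective]
  change Nat.card (Submonoid.powers _) = m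
  rw [← Nat.card_congr (finEquivPowers hfin), Nat.card_fin, hord]

theorem dvd_and_dvd_of_pow_add_pow_eq_two {p m a b : ℕ} (hp : 3 ≤ p) (hm : 2 ≤ m)
    (h : (p : ZMod (p ^ m - 1)) ^ a + (p : ZMod (p ^ m - 1)) ^ b = 2) : m ∣ a ∧ m ∣ b := by
  have hred (i : ℕ) : (p : ZMod (p ^ m - 1)) ^ i = (p ^ (i % m) : ℕ) := by
    have hord := orderOf_natCast_zmod_pow_sub_one (p := p) (m := m) (by lia) (by lia)
    rw [Nat.cast_pow, ← pow_mod_orderOf _ i, hord]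
  have hle (i : ℕ) : p ^ (i % m) ≤ p ^ (m - 1) :=
    Nat.pow_le_pow_right (by lia) (Nat.le_sub_one_of_lt (Nat.mod_lt i (by lia)))
  have hbig : 2 * p ^ (m - 1) < p ^ m - 1 := by
    have hpow : p ^ m = p ^ (m - 1) * p := by rw [← pow_succ, Nat.sub_add_cancel (by lia)]
    have := Nat.mul_le_mul_left (p ^ (m - 1)) hp
    have := Nat.one_lt_pow (show m - 1 ≠ 0 by lia) (show 1 < p by lia)
    lia
  have hsum : p ^ (a % m) + p ^ (b % m) = 2 := by
    rw [hred, hred] at h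
    have hmod : p ^ (a % m) + p ^ (b % m) ≡ 2 [MOD p ^ m - 1] := by
      rw [← ZMod.natCast_eq_natCast_iff]
      exact_mod_cast h
    have := hle a
    have := hle b
    have := Nat.one_le_pow (m - 1) p (by lia)
    exact hmod.eq_of_lt_of_lt (by lia) (by lia)
  have hzero (i : ℕ) (hi : p ^ (i % m) ≤ 1) : m ∣ i := by
    refine Nat.dvd_of_mod_eq_zero ?_
    by_contra hne
    exact absurd hi (Nat.one_lt_pow hne (by lia)).not_ge
  have hpos (i : ℕ) := Nat.one_le_pow i p (by lia)
  exact ⟨hzero a (by have := hpos (b % m); lia), hzero b (by have := hpos (a % m); lia)⟩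

theorem disjoint_cyclotomicCoset_one {p m h v : ℕ} (hp : 3 ≤ p) (hm : 2 ≤ m) (hmh : ¬ m ∣ h)
    (hv : v * (p ^ h + 1) ≡ 2 [MOD p ^ m - 1]) :
    Disjoint (cyclotomicCoset p (p ^ m - 1) 1) (cyclotomicCoset p (p ^ m - 1) v) := by
  rw [Set.disjoint_left]
  rintro _ ⟨i, rfl⟩ ⟨j, hij⟩
  rw [← ZMod.natCast_eq_natCast_iff] at hv
  push_cast at hv hij
  have hinv : (p : ZMod (p ^ m - 1)) ^ j * (p : ZMod (p ^ m - 1)) ^ ((m - 1) * j) = 1 := by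
    obtain ⟨c, rfl⟩ := Nat.exists_eq_add_of_le' (show 1 ≤ m by lia)
    rw [← pow_add, Nat.add_sub_cancel, add_comm j, ← Nat.succ_mul, pow_mul,
      natCast_pow_eq_one p _ (by lia), one_pow]
  obtain ⟨hleft, hright⟩ := dvd_and_dvd_of_pow_add_pow_eq_two
    (a := i + (m - 1) * j + h) (b := i + (m - 1) * j) hp hm (by
      rw [pow_add _ _ h, pow_add, ← hv]
      linear_combination ((p : ZMod (p ^ m - 1)) ^ h + 1) *
        ((p : ZMod (p ^ m - 1)) ^ ((m - 1) * j) * hij + v * hinv))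
  exact hmh ((Nat.dvd_add_right hright).1 hleft)

theorem sq_add_prime_mul_sq_eq_pow {p : ℕ} (hp : p.Prime) {k : ℕ} {t d : ℤ}
    (h : t ^ 2 + p * d ^ 2 = p ^ k) : (Even k ∧ d = 0) ∨ (Odd k ∧ t = 0) := by
  induction k generalizing t d with
  | zero =>
    refine Or.inl ⟨Even.zero, ?_⟩
    by_contra hd
    have hp2 : (2 : ℤ) ≤ p := by exact_mod_cast hp.two_le
    have hd2 : 0 < d ^ 2 := by positivity
    nlinarith [sq_nonneg t]
  | succ k ih =>
    obtain ⟨s, rfl⟩ : (p : ℤ) ∣ t :=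
      (Nat.prime_iff_prime_int.1 hp).dvd_of_dvd_pow (n := 2)
        ⟨p ^ k - d ^ 2, by rw [mul_sub, ← pow_succ']; linarith⟩
    have hswap : d ^ 2 + p * s ^ 2 = p ^ k := by
      have hp0 : (p : ℤ) ≠ 0 := by exact_mod_cast hp.ne_zero
      refine mul_left_cancel₀ hp0 ?_
      linear_combination h
    rcases ih hswap with ⟨hk, rfl⟩ | ⟨hk, rfl⟩
    · exact Or.inr ⟨hk.add_one, mul_zero _⟩
    · exact Or.inl ⟨hk.add_one, rfl⟩

theorem eq_zero_or_sq_eq_three_pow_succ {m r : ℕ} (hm : Odd m) (hr : r ≤ 2) {t d : ℤ}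
    (h : 4 * t ^ 2 + 3 * d ^ 2 = 4 * 3 ^ (m + r)) : t = 0 ∨ t ^ 2 = 3 ^ (m + 1) := by
  obtain ⟨e, rfl⟩ : (2 : ℤ) ∣ d := Int.prime_two.dvd_of_dvd_pow (n := 2) (by lia)
  have hsq : t ^ 2 + (3 : ℕ) * e ^ 2 = (3 : ℕ) ^ (m + r) := by
    push_cast
    lia
  rcases sq_add_prime_mul_sq_eq_pow Nat.prime_three hsq with ⟨heven, rfl⟩ | ⟨-, ht⟩
  · obtain rfl : r = 1 := by grind
    exact Or.inr (by simpa using hsq)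
  · exact Or.inl ht

section CubicCharacter

theorem stdAddChar_three_ne_one : (ZMod.stdAddChar : AddChar (ZMod 3) ℂ) ≠ 1 := by
  simpa [AddChar.mulShift_one] using ZMod.isPrimitive_stdAddChar 3 (a := 1) one_ne_zero

theorem one_add_stdAddChar_one_add_neg_one :
    1 + ZMod.stdAddChar (1 : ZMod 3) + ZMod.stdAddChar (-1 : ZMod 3) = 0 := by
  have h := AddChar.sum_eq_zero_of_ne_one stdAddChar_three_ne_one
  rw [← AddChar.map_zero_eq_one (ZMod.stdAddChar : AddChar (ZMod 3) ℂ)]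
  exact (Fin.sum_univ_three (ZMod.stdAddChar : ZMod 3 → ℂ)).symm.trans h

theorem stdAddChar_one_sub_neg_one_sq :
    (ZMod.stdAddChar (1 : ZMod 3) - ZMod.stdAddChar (-1 : ZMod 3)) ^ 2 = -3 := by
  have hsum := one_add_stdAddChar_one_add_neg_one
  have hmul : ZMod.stdAddChar (1 : ZMod 3) * ZMod.stdAddChar (-1 : ZMod 3) = 1 := by
    rw [← AddChar.map_add_eq_mul, add_neg_cancel, AddChar.map_zero_eq_one]
  linear_combination (ZMod.stdAddChar (1 : ZMod 3) + ZMod.stdAddChar (-1 : ZMod 3) - 1) * hsum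
    - 4 * hmul

theorem stdAddChar_sub_neg (t : ZMod 3) :
    ZMod.stdAddChar t - ZMod.stdAddChar (-t) =
      t.valMinAbs * (ZMod.stdAddChar (1 : ZMod 3) - ZMod.stdAddChar (-1 : ZMod 3)) := by
  obtain rfl | rfl | rfl : t = 0 ∨ t = 1 ∨ t = -1 := by revert t; decide
  · simp
  · rw [show (1 : ZMod 3).valMinAbs = 1 by decide, Int.cast_one, one_mul]
  · rw [show (-1 : ZMod 3).valMinAbs = -1 by decide, neg_neg]
    push_cast
    ring

theorem stdAddChar_add_neg (t : ZMod 3) :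
    ZMod.stdAddChar t + ZMod.stdAddChar (-t) = 2 - 3 * if t ≠ 0 then 1 else 0 := by
  have hsum := one_add_stdAddChar_one_add_neg_one
  obtain rfl | rfl | rfl : t = 0 ∨ t = 1 ∨ t = -1 := by revert t; decide
  · norm_num
  · rw [if_pos (by decide)]
    linear_combination hsum
  · rw [if_pos (by decide), neg_neg]
    linear_combination hsum

variable {X : Type*} [Fintype X] (f : X → ZMod 3)

theorem conj_sum_stdAddChar :
    conj (∑ x, ZMod.stdAddChar (f x)) = ∑ x, ZMod.stdAddChar (-f x) := by
  rw [map_sum]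
  exact Finset.sum_congr rfl fun x _ => (AddChar.map_neg_eq_conj _ _).symm

theorem exists_four_mul_sum_mul_conj : ∃ d : ℤ,
    4 * ((∑ x, ZMod.stdAddChar (f x)) * conj (∑ x, ZMod.stdAddChar (f x))) =
      ((∑ x, ZMod.stdAddChar (f x)) + conj (∑ x, ZMod.stdAddChar (f x))) ^ 2 + 3 * d ^ 2 := by
  refine ⟨∑ x, (f x).valMinAbs, ?_⟩
  have hsub : (∑ x, ZMod.stdAddChar (f x)) - conj (∑ x, ZMod.stdAddChar (f x)) =
      (∑ x, (f x).valMinAbs : ℤ) *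
        (ZMod.stdAddChar (1 : ZMod 3) - ZMod.stdAddChar (-1 : ZMod 3)) := by
    rw [conj_sum_stdAddChar, ← Finset.sum_sub_distrib, Int.cast_sum, Finset.sum_mul]
    exact Finset.sum_congr rfl fun x _ => stdAddChar_sub_neg (f x)
  set S := ∑ x, ZMod.stdAddChar (f x)
  set N : ℤ := ∑ x, (f x).valMinAbs
  have hsq : (S - conj S) ^ 2 = -3 * (N : ℂ) ^ 2 := by
    rw [hsub, mul_pow, stdAddChar_one_sub_neg_one_sq, mul_comm]
  linear_combination -hsq

theorem sum_stdAddChar_add_conj :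
    (∑ x, ZMod.stdAddChar (f x)) + conj (∑ x, ZMod.stdAddChar (f x)) =
      2 * Fintype.card X - 3 * ((Finset.univ.filter fun x => f x ≠ 0).card : ℂ) := by
  rw [conj_sum_stdAddChar, ← Finset.sum_add_distrib,
    Finset.sum_congr rfl fun x _ => stdAddChar_add_neg (f x), Finset.sum_sub_distrib,
    ← Finset.mul_sum, Finset.sum_boole, Finset.sum_const, Finset.card_univ, nsmul_eq_mul, mul_comm]

variable {f} [InvolutiveNeg X]

theorem card_filter_ne_zero_of_odd (hf : Function.Odd f) :
    (Finset.univ.filter fun x => f x ≠ 0).card =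
      2 * (Finset.univ.filter fun x => f x = 1).card := by
  classical
  have hneg : (Finset.univ.filter fun x => f x = -1).card =
      (Finset.univ.filter fun x => f x = 1).card :=
    Finset.card_equiv (Equiv.neg X) fun x => by simp [hf x, neg_eq_iff_eq_neg]
  have hsplit : (Finset.univ.filter fun x => f x ≠ 0) =
      (Finset.univ.filter fun x => f x = 1) ∪ Finset.univ.filter fun x => f x = -1 := by
    ext x
    have : ∀ t : ZMod 3, t ≠ 0 ↔ t = 1 ∨ t = -1 := by decide
    simpa using this (f x)
  have hdisj : Disjoint (Finset.univ.filter fun x => f x = 1)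
      (Finset.univ.filter fun x => f x = -1) :=
    Finset.disjoint_filter.2 fun x _ h => by rw [h]; decide
  rw [hsplit, Finset.card_union_of_disjoint hdisj, hneg, two_mul]

theorem sum_stdAddChar_of_odd (hf : Function.Odd f) :
    ∑ x, ZMod.stdAddChar (f x) =
      Fintype.card X - 3 * ((Finset.univ.filter fun x => f x = 1).card : ℂ) := by
  have hreal : conj (∑ x, ZMod.stdAddChar (f x)) = ∑ x, ZMod.stdAddChar (f x) := by
    rw [conj_sum_stdAddChar, ← Equiv.sum_comp (Equiv.neg X)]
    simp [hf _]
  have h := sum_stdAddChar_add_conj f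
  rw [hreal, card_filter_ne_zero_of_odd hf] at h
  push_cast at h
  linear_combination h / 2

end CubicCharacter

theorem sum_addChar_quadraticForm_mul_conj {R V : Type*} [CommRing R] [Finite R]
    [Invertible (2 : R)] [AddCommGroup V] [Module R V] [Fintype V] {ψ : AddChar R ℂ}
    (hψ : ψ.IsPrimitive) (Q : QuadraticForm R V) :
    (∑ z, ψ (Q z)) * conj (∑ z, ψ (Q z)) =
      Fintype.card V * (Nat.card (LinearMap.ker Q.polarBilin) : ℂ) := by
  classical
  have hpolar (z w : V) : ψ (Q (z + w)) * conj (ψ (Q w)) = ψ (Q z) * ψ (Q.polarBilin z w) := by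
    rw [← AddChar.map_neg_eq_conj, ← AddChar.map_add_eq_mul, ← AddChar.map_add_eq_mul,
      QuadraticMap.polarBilin_apply_apply, QuadraticMap.polar]
    congr 1
    ring
  have hinner (z : V) : ∑ w, ψ (Q.polarBilin z w) =
      if z ∈ LinearMap.ker Q.polarBilin then (Fintype.card V : ℂ) else 0 := by
    have h := AddChar.sum_eq_ite (ψ.compAddMonoidHom (Q.polarBilin z).toAddMonoidHom)
    refine h.trans (if_congr ⟨fun h1 => ?_, fun h1 => ?_⟩ rfl rfl)
    · refine LinearMap.mem_ker.2 (LinearMap.ext fun w => ?_)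
      by_contra hw
      refine hψ hw (DFunLike.ext _ _ fun r => ?_)
      have := DFunLike.congr_fun h1 (r • w)
      simpa [mul_comm] using this
    · ext w
      simp [LinearMap.mem_ker.1 h1]
  have hradical (z : V) (hz : z ∈ LinearMap.ker Q.polarBilin) : ψ (Q z) = 1 := by
    rw [← QuadraticMap.radical_eq_ker_polarBilin] at hz
    rw [hz.1, AddChar.map_zero_eq_one]
  calc (∑ z, ψ (Q z)) * conj (∑ z, ψ (Q z))
      = ∑ w, ∑ z, ψ (Q z) * conj (ψ (Q w)) := by
        rw [map_sum, Finset.sum_mul_sum, Finset.sum_comm]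
    _ = ∑ w, ∑ z, ψ (Q (z + w)) * conj (ψ (Q w)) :=
        Finset.sum_congr rfl fun w _ => (Equiv.sum_comp (Equiv.addRight w) _).symm
    _ = ∑ z, ψ (Q z) * ∑ w, ψ (Q.polarBilin z w) := by
        rw [Finset.sum_comm]
        simp_rw [hpolar, Finset.mul_sum]
    _ = ∑ z, if z ∈ LinearMap.ker Q.polarBilin then (Fintype.card V : ℂ) else 0 :=
        Finset.sum_congr rfl fun z _ => by
          rw [hinner]
          split_ifs with hz
          · rw [hradical z hz, one_mul]
          · rw [mul_zero]
    _ = _ := by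
        rw [← Finset.sum_filter, Finset.sum_const, nsmul_eq_mul, mul_comm,
          ← Fintype.card_subtype, Nat.card_eq_fintype_card]

section TwistedTraceForm

variable {F K : Type*} [Field F] [Field K] [Algebra F K] {σ : K ≃ₐ[F] K}

theorem finrank_le_one_of_first_order (hσ : ∀ x, σ x = x → x ∈ Set.range (algebraMap F K))
    {A B : K} (hAB : A ≠ 0 ∨ B ≠ 0) {W : Submodule F K} (hW : ∀ z ∈ W, A * σ z + B * z = 0) :
    Module.finrank F W ≤ 1 := by
  rcases eq_or_ne W ⊥ with rfl | hne
  · simp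
  obtain ⟨w, hw, hw0⟩ := W.ne_bot_iff.1 hne
  have hA : A ≠ 0 := by
    rintro rfl
    have hB : B = 0 := by simpa [hw0] using hW w hw
    simp [hB] at hAB
  refine finrank_le_one (⟨w, hw⟩ : W) fun z => ?_
  have hfixed : σ (z / w) = z / w := by
    have hσw : σ w ≠ 0 := (map_ne_zero σ).2 hw0
    rw [map_div₀, div_eq_div_iff hσw hw0]
    refine mul_left_cancel₀ hA ?_
    linear_combination w * hW z z.2 - z * hW w hw
  obtain ⟨c, hc⟩ := hσ _ hfixed
  exact ⟨c, Subtype.ext (by simp [Algebra.smul_def, hc, hw0])⟩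

-- If `z₁ ≠ 0` is one solution, then `y = σ (z / z₁) - z / z₁` satisfies a first-order equation
-- for every solution `z`.
theorem finrank_le_two_of_second_order [FiniteDimensional F K]
    (hσ : ∀ x, σ x = x → x ∈ Set.range (algebraMap F K)) {A B C : K}
    (hABC : A ≠ 0 ∨ B ≠ 0 ∨ C ≠ 0) {W : Submodule F K}
    (hW : ∀ z ∈ W, A * σ (σ z) + B * σ z + C * z = 0) : Module.finrank F W ≤ 2 := by
  rcases eq_or_ne W ⊥ with rfl | hne
  · simp
  obtain ⟨z₁, hz₁, hz0⟩ := W.ne_bot_iff.1 hne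
  have hσz : σ z₁ ≠ 0 := (map_ne_zero σ).2 hz0
  have hσσz : σ (σ z₁) ≠ 0 := (map_ne_zero σ).2 hσz
  let D : K →ₗ[F] K := (σ.toLinearMap - LinearMap.id) ∘ₗ LinearMap.mulRight F z₁⁻¹
  have hD (z : K) : D z = σ z / σ z₁ - z / z₁ := by simp [D, div_eq_mul_inv]
  have hker : Module.finrank F (LinearMap.ker (D.domRestrict W)) ≤ 1 := by
    rw [← Submodule.finrank_map_subtype_eq]
    refine finrank_le_one_of_first_order hσ (A := z₁) (B := -σ z₁) (Or.inl hz0) ?_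
    rintro _ ⟨z, hz, rfl⟩
    have hz : D z = 0 := hz
    rw [hD, sub_eq_zero, div_eq_div_iff hσz hz0] at hz
    rw [Submodule.subtype_apply]
    linear_combination hz
  have hrange : Module.finrank F (LinearMap.range (D.domRestrict W)) ≤ 1 := by
    refine finrank_le_one_of_first_order hσ (A := A * σ (σ z₁)) (B := -(C * z₁)) ?_ ?_
    · by_contra! h
      obtain ⟨hA, hC⟩ : A = 0 ∧ C = 0 := by simpa [hz0, hσσz] using h
      have := hW z₁ hz₁
      simp_all
    · rintro _ ⟨z, rfl⟩
      rw [LinearMap.domRestrict_apply, hD]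
      simp only [map_sub, map_div₀]
      field_simp
      linear_combination σ z₁ * hW z z.2 - σ z * hW z₁ hz₁
  have := LinearMap.finrank_range_add_finrank_ker (D.domRestrict W)
  lia

/-- The quadratic form `z ↦ Tr (a z σ(z) + b z²)` attached to an automorphism `σ` of `K / F`. -/
noncomputable def twistedTraceForm (σ : K ≃ₐ[F] K) (a b : K) : QuadraticForm F K :=
  LinearMap.BilinMap.toQuadraticMap ((Algebra.traceForm F K).compl₂
    (LinearMap.mulLeft F a ∘ₗ σ.toLinearMap + LinearMap.mulLeft F b))

theorem twistedTraceForm_apply (a b z : K) :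
    twistedTraceForm σ a b z = Algebra.trace F K (z * (a * σ z + b * z)) := rfl

variable [FiniteDimensional F K] [Algebra.IsSeparable F K]

theorem mem_ker_polarBilin_twistedTraceForm {a b z : K} :
    z ∈ LinearMap.ker (twistedTraceForm σ a b).polarBilin ↔
      σ a * σ (σ z) + 2 * σ b * σ z + a * z = 0 := by
  have hpolar (w : K) : (twistedTraceForm σ a b).polarBilin z w = Algebra.traceForm F K
      (σ a * σ (σ z) + 2 * σ b * σ z + a * z) (σ w) := by
    rw [twistedTraceForm, LinearMap.BilinMap.polarBilin_toQuadraticMap]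
    have hσ := Algebra.trace_eq_of_algEquiv σ (w * (a * σ z + 2 * b * z))
    simp only [map_mul, map_add, map_ofNat] at hσ
    simp only [LinearMap.add_apply, LinearMap.flip_apply, LinearMap.compl₂_apply,
      LinearMap.comp_apply, LinearMap.mulLeft_apply, AlgEquiv.toLinearMap_apply,
      Algebra.traceForm_apply]
    calc Algebra.trace F K (z * (a * σ w + b * w)) + Algebra.trace F K (w * (a * σ z + b * z))
        = Algebra.trace F K (a * z * σ w) + Algebra.trace F K (w * (a * σ z + 2 * b * z)) := by
          rw [← map_add, ← map_add]
          congr 1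
          ring
      _ = _ := by
          rw [← hσ, ← map_add]
          congr 1
          ring
  rw [LinearMap.mem_ker]
  constructor
  · refine fun h => (traceForm_nondegenerate F K).1 _ fun w => ?_
    obtain ⟨w, rfl⟩ := σ.surjective w
    rw [← hpolar, h, LinearMap.zero_apply]
  · refine fun h => LinearMap.ext fun w => ?_
    rw [hpolar, h, map_zero, LinearMap.zero_apply, LinearMap.zero_apply]

theorem finrank_ker_polarBilin_twistedTraceForm_le_two
    (hσ : ∀ x, σ x = x → x ∈ Set.range (algebraMap F K)) (h2 : (2 : K) ≠ 0) {a b : K}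
    (hab : (a, b) ≠ 0) :
    Module.finrank F (LinearMap.ker (twistedTraceForm σ a b).polarBilin) ≤ 2 := by
  refine finrank_le_two_of_second_order hσ (A := σ a) (B := 2 * σ b) (C := a) ?_
    fun z => mem_ker_polarBilin_twistedTraceForm.1
  rw [Ne, Prod.mk_eq_zero, not_and_or] at hab
  rcases hab with ha | hb
  · exact Or.inr (Or.inr ha)
  · exact Or.inr (Or.inl (mul_ne_zero h2 ((map_ne_zero σ).2 hb)))

end TwistedTraceForm

theorem exists_sum_twistedTraceForm_mul_conj {F K : Type*} [Field F] [Fintype F] [Field K]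
    [Algebra F K] [Fintype K] (h2 : (2 : F) ≠ 0) {ψ : AddChar F ℂ} (hψ : ψ.IsPrimitive)
    {σ : K ≃ₐ[F] K} (hσ : ∀ x, σ x = x → x ∈ Set.range (algebraMap F K)) {a b : K}
    (hab : (a, b) ≠ 0) :
    ∃ r ≤ 2, (∑ z, ψ (twistedTraceForm σ a b z)) * conj (∑ z, ψ (twistedTraceForm σ a b z)) =
      Fintype.card K * (Fintype.card F : ℂ) ^ r := by
  have : Invertible (2 : F) := invertibleOfNonzero h2
  have hK2 : (2 : K) ≠ 0 := by
    simpa only [map_ofNat] using (map_ne_zero (algebraMap F K)).2 h2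
  refine ⟨_, finrank_ker_polarBilin_twistedTraceForm_le_two hσ hK2 hab, ?_⟩
  rw [sum_addChar_quadraticForm_mul_conj hψ, Module.natCard_eq_pow_finrank (K := F),
    Nat.card_eq_fintype_card, Nat.cast_pow]

section FiniteFieldPowers

variable {K : Type*} [Field K]

theorem pow_eq_pow_of_modEq_card_sub_one [Fintype K] {a b : ℕ} (ha : a ≠ 0) (hb : b ≠ 0)
    (h : a ≡ b [MOD Fintype.card K - 1]) (x : K) : x ^ a = x ^ b := by
  rcases eq_or_ne x 0 with rfl | hx
  · rw [zero_pow ha, zero_pow hb]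
  · lift x to Kˣ using isUnit_iff_ne_zero.2 hx
    have hunit : x ^ a = x ^ b := pow_eq_pow_iff_modEq.2 (h.of_dvd (orderOf_dvd_of_pow_eq_one
      (Units.ext (by simpa using FiniteField.pow_card_sub_one_eq_one (x : K) hx))))
    exact_mod_cast congrArg Units.val hunit

theorem pow_bijective_of_coprime_card_sub_one [Fintype K] {v : ℕ} (hv0 : v ≠ 0)
    (hv : v.Coprime (Fintype.card K - 1)) : Function.Bijective fun x : K => x ^ v := by
  refine Finite.injective_iff_bijective.1 fun x y (hxy : x ^ v = y ^ v) => ?_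
  rcases eq_or_ne y 0 with rfl | hy
  · exact eq_zero_of_pow_eq_zero (hxy.trans (zero_pow hv0))
  have hx : x ≠ 0 := by
    rintro rfl
    rw [zero_pow hv0] at hxy
    exact hy (eq_zero_of_pow_eq_zero hxy.symm)
  lift x to Kˣ using isUnit_iff_ne_zero.2 hx
  lift y to Kˣ using isUnit_iff_ne_zero.2 hy
  have hcop : (Nat.card Kˣ).Coprime v := by
    rw [Nat.card_units, Nat.card_eq_fintype_card]
    exact hv.symm
  exact congrArg Units.val ((powCoprime hcop).injective (Units.ext (by simpa using hxy)))

theorem sum_comp_sq_add_sum_comp_neg_sq [Fintype K] (hK : Fintype.card K % 4 = 3)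
    {R : Type*} [CommRing R] (g : K → R) :
    ∑ z, g (z ^ 2) + ∑ z, g (-z ^ 2) = 2 * ∑ y, g y := by
  classical
  have hchar : ringChar K ≠ 2 := by
    rw [Ne, FiniteField.even_card_iff_char_two]
    lia
  have hsq (g : K → R) : ∑ z, g (z ^ 2) = ∑ y, ((quadraticChar K y : ℤ) + 1 : R) * g y := by
    rw [← Finset.sum_fiberwise Finset.univ (fun z : K => z ^ 2)]
    refine Finset.sum_congr rfl fun y _ => ?_
    rw [Finset.sum_congr rfl (g := fun _ => g y)
      (fun x hx => by rw [(Finset.mem_filter.1 hx).2]), Finset.sum_const, nsmul_eq_mul]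
    have hcard := congrArg (Int.cast : ℤ → R) (quadraticChar_card_sqrts hchar y)
    rw [Set.toFinset_ofPred] at hcard
    push_cast at hcard
    rw [hcard]
  have hneg (y : K) : quadraticChar K (-y) = -quadraticChar K y := by
    have hneg_one : quadraticChar K (-1) = -1 := by
      rw [quadraticChar_neg_one_iff_not_isSquare, FiniteField.isSquare_neg_one_iff, hK, not_not]
    rw [← neg_one_mul, map_mul, hneg_one, neg_one_mul]
  rw [hsq g, hsq (fun y => g (-y)), ← Equiv.sum_comp (Equiv.neg K) (fun y => _ * g (-y)),
    ← Finset.sum_add_distrib, Finset.mul_sum]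
  refine Finset.sum_congr rfl fun y _ => ?_
  simp only [Equiv.neg_apply, neg_neg, hneg]
  push_cast
  ring

theorem sum_comp_pow_add_sum_comp_neg_pow [Fintype K] (hK : Fintype.card K % 4 = 3) {v k : ℕ}
    (hv : Odd v) (hk : k ≠ 0) (hvk : v * k ≡ 2 [MOD Fintype.card K - 1])
    {R : Type*} [CommRing R] (g : K → R) :
    ∑ z, g (z ^ k) + ∑ z, g (-z ^ k) = 2 * ∑ x, g x := by
  let P := Equiv.ofBijective _ (pow_bijective_of_coprime_card_sub_one (K := K) hv.pos.ne'
    (coprime_of_odd_of_mul_modEq_two hv hvk))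
  have hP (z : K) : P.symm (z ^ 2) = z ^ k := by
    rw [Equiv.symm_apply_eq, Equiv.ofBijective_apply, ← pow_mul, mul_comm]
    exact Eq.symm <| pow_eq_pow_of_modEq_card_sub_one (mul_ne_zero hv.pos.ne' hk) two_ne_zero hvk z
  have hPneg (z : K) : P.symm (-z ^ 2) = -z ^ k := by
    rw [Equiv.symm_apply_eq, Equiv.ofBijective_apply, hv.neg_pow, ← hP]
    exact congrArg Neg.neg (P.apply_symm_apply (z ^ 2)).symm
  simpa only [Function.comp_apply, hP, hPneg, Equiv.sum_comp]
    using sum_comp_sq_add_sum_comp_neg_sq hK (g ∘ P.symm)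

theorem mem_range_algebraMap_of_frobenius_pow_eq {F : Type*} [Field F] [Fintype F] [Algebra F K]
    [Finite K] {h : ℕ} (hcop : h.Coprime (Module.finrank F K)) {x : K}
    (hx : (FiniteField.frobeniusAlgEquivOfAlgebraic F K ^ h) x = x) :
    x ∈ Set.range (algebraMap F K) := by
  set φ := FiniteField.frobeniusAlgEquivOfAlgebraic F K
  have hfinrank : (φ ^ Module.finrank F K) x = x := by
    rw [← FiniteField.orderOf_frobeniusAlgEquivOfAlgebraic, pow_orderOf_eq_one, AlgEquiv.one_apply]
  rw [AlgEquiv.coe_pow] at hx hfinrank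
  have hφ : Function.IsFixedPt φ x := by
    have hgcd := Function.IsPeriodicPt.gcd hx hfinrank
    rwa [hcop.gcd_eq_one] at hgcd
  refine (IsGalois.mem_range_algebraMap_iff_fixed x).2 fun τ => ?_
  obtain ⟨n, rfl⟩ := (FiniteField.bijective_frobeniusAlgEquivOfAlgebraic_pow F K).2 τ
  exact (AlgEquiv.coe_pow φ n ▸ hφ.iterate n :)

end FiniteFieldPowers

/-- The additive character of `K` obtained from one of `F` through the trace. -/
noncomputable def traceChar {F R : Type*} [Field F] [CommRing R] (K : Type*) [Field K]
    [Algebra F K] (ψ : AddChar F R) : AddChar K R :=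
  ψ.compAddMonoidHom (Algebra.trace F K).toAddMonoidHom

theorem isPrimitive_traceChar {F R K : Type*} [Field F] [CommRing R] [Field K] [Algebra F K]
    [FiniteDimensional F K] [Algebra.IsSeparable F K] {ψ : AddChar F R} (hψ : ψ ≠ 1) :
    (traceChar K ψ).IsPrimitive := by
  refine AddChar.IsPrimitive.of_ne_one fun h => hψ (DFunLike.ext _ _ fun t => ?_)
  obtain ⟨x, rfl⟩ := Algebra.trace_surjective F K t
  exact DFunLike.congr_fun h x

/-- The Walsh coefficient at `c` of the map `φ : K → K` with respect to `ψ`. -/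
noncomputable def walshSum {K R : Type*} [Field K] [Fintype K] [CommRing R] (ψ : AddChar K R)
    (φ : K → K) (c : K × K) : R :=
  ∑ x, ψ (c.1 * x + c.2 * φ x)

section Moments

variable {K R : Type*} [Field K] [Fintype K] [CommRing R] [IsDomain R] {ψ : AddChar K R}

theorem sum_addChar_mul_add_mul [DecidableEq K] (hψ : ψ.IsPrimitive) (a b : K) :
    ∑ c : K × K, ψ (c.1 * a + c.2 * b) =
      if a = 0 ∧ b = 0 then (Fintype.card K : R) ^ 2 else 0 := by
  simp only [AddChar.map_add_eq_mul, Fintype.sum_prod_type, ← Finset.mul_sum, ← Finset.sum_mul,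
    AddChar.sum_mulShift _ hψ]
  split_ifs <;> simp_all [sq]

theorem sum_walshSum (hψ : ψ.IsPrimitive) {φ : K → K} (hφ : φ 0 = 0) :
    ∑ c, walshSum ψ φ c = (Fintype.card K : R) ^ 2 := by
  classical
  have hzero (x : K) : (x = 0 ∧ φ x = 0) ↔ x = 0 := and_iff_left_of_imp fun h => h ▸ hφ
  simp only [walshSum]
  rw [Finset.sum_comm]
  simp [sum_addChar_mul_add_mul hψ, hzero]

theorem sum_walshSum_sq (hψ : ψ.IsPrimitive) {φ : K → K} (hφ : Function.Odd φ) :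
    ∑ c, walshSum ψ φ c ^ 2 = (Fintype.card K : R) ^ 3 := by
  classical
  have hzero (x y : K) : (x + y = 0 ∧ φ x + φ y = 0) ↔ y = -x := by
    rw [add_comm x, ← eq_neg_iff_add_eq_zero]
    refine and_iff_left_of_imp ?_
    rintro rfl
    rw [hφ, add_neg_cancel]
  calc ∑ c, walshSum ψ φ c ^ 2
      = ∑ c : K × K, ∑ x, ∑ y, ψ (c.1 * (x + y) + c.2 * (φ x + φ y)) := by
        refine Finset.sum_congr rfl fun c _ => ?_
        rw [walshSum, sq, Finset.sum_mul_sum]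
        simp only [← AddChar.map_add_eq_mul]
        exact Finset.sum_congr rfl fun x _ => Finset.sum_congr rfl fun y _ =>
          congrArg ψ (by ring)
    _ = ∑ x, ∑ y, ∑ c : K × K, ψ (c.1 * (x + y) + c.2 * (φ x + φ y)) := by
        rw [Finset.sum_comm]
        exact Finset.sum_congr rfl fun x _ => Finset.sum_comm
    _ = _ := by simp [sum_addChar_mul_add_mul hψ, hzero, pow_succ']

end Moments

/-- For every `c ≠ 0` the Walsh coefficient of `φ` at `c` is `0`, `e` or `-e`. -/
def HasThreeValuedWalshSum {K R : Type*} [Field K] [Fintype K] [CommRing R] (ψ : AddChar K R)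
    (φ : K → K) (e : R) : Prop :=
  ∀ c ≠ 0, walshSum ψ φ c = 0 ∨ walshSum ψ φ c = e ∨ walshSum ψ φ c = -e

section ThreeValuedCounts

variable {X R : Type*} [CommRing R] [DecidableEq R] {s : Finset X} {f : X → R}
  {e : R}

theorem two_mul_sq_mul_card_filter_eq [IsDomain R] [CharZero R] (he : e ≠ 0)
    (hf : ∀ x ∈ s, f x = 0 ∨ f x = e ∨ f x = -e) :
    2 * e ^ 2 * (s.filter fun x => f x = e).card = ∑ x ∈ s, f x ^ 2 + e * ∑ x ∈ s, f x := by
  rw [← Finset.sum_boole, Finset.mul_sum, Finset.mul_sum, ← Finset.sum_add_distrib]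
  refine Finset.sum_congr rfl fun x hx => ?_
  rcases hf x hx with h | h | h <;> rw [h]
  · simp [he.symm]
  · rw [if_pos rfl]
    ring
  · rw [if_neg (neg_ne_self.2 he)]
    ring

theorem sq_mul_card_filter_eq_zero (he : e ≠ 0)
    (hf : ∀ x ∈ s, f x = 0 ∨ f x = e ∨ f x = -e) :
    e ^ 2 * (s.filter fun x => f x = 0).card = e ^ 2 * s.card - ∑ x ∈ s, f x ^ 2 := by
  rw [← Finset.sum_boole, Finset.card_eq_sum_ones, Nat.cast_sum, Finset.mul_sum, Finset.mul_sum,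
    ← Finset.sum_sub_distrib]
  refine Finset.sum_congr rfl fun x hx => ?_
  rcases hf x hx with h | h | h <;> simp [h, he]

end ThreeValuedCounts

section WalshCounts

variable {K R : Type*} [Field K] [Fintype K] [CommRing R] {ψ : AddChar K R} {φ : K → K} {e : R}

theorem HasThreeValuedWalshSum.neg (h : HasThreeValuedWalshSum ψ φ e) :
    HasThreeValuedWalshSum ψ φ (-e) := fun c hc =>
  (h c hc).imp_right fun h => by rwa [neg_neg, or_comm]

theorem walshSum_zero : walshSum ψ φ 0 = Fintype.card K := by
  simp [walshSum]

variable [DecidableEq R]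

theorem filter_erase_zero_walshSum_eq [DecidableEq K] {d : R} (hd : (Fintype.card K : R) ≠ d) :
    (Finset.univ.erase 0).filter (fun c => walshSum ψ φ c = d) =
      Finset.univ.filter fun c => walshSum ψ φ c = d := by
  rw [Finset.filter_erase, Finset.erase_eq_of_notMem]
  simpa [walshSum_zero] using hd

variable [IsDomain R] [CharZero R]

theorem two_mul_sq_mul_card_walshSum_eq (hψ : ψ.IsPrimitive) (hφ : Function.Odd φ)
    (hφ0 : φ 0 = 0) (he : e ≠ 0) (heq : (Fintype.card K : R) ≠ e)
    (h : HasThreeValuedWalshSum ψ φ e) :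
    2 * e ^ 2 * (Finset.univ.filter fun c => walshSum ψ φ c = e).card =
      Fintype.card K * (Fintype.card K - 1) * (Fintype.card K + e) := by
  classical
  rw [← filter_erase_zero_walshSum_eq heq, two_mul_sq_mul_card_filter_eq he
    fun c hc => h c (Finset.ne_of_mem_erase hc), Finset.sum_erase_eq_sub (Finset.mem_univ _),
    Finset.sum_erase_eq_sub (Finset.mem_univ _), sum_walshSum_sq hψ hφ,
    sum_walshSum hψ hφ0, walshSum_zero]
  ring

theorem sq_mul_card_walshSum_eq_zero (hψ : ψ.IsPrimitive) (hφ : Function.Odd φ)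
    (he : e ≠ 0) (h : HasThreeValuedWalshSum ψ φ e) :
    e ^ 2 * (Finset.univ.filter fun c => walshSum ψ φ c = 0).card =
      ((Fintype.card K : R) - 1) * (e ^ 2 * (Fintype.card K + 1) - Fintype.card K ^ 2) := by
  classical
  have hq : (Fintype.card K : R) ≠ 0 := Nat.cast_ne_zero.2 Fintype.card_ne_zero
  have hcard : ((Finset.univ.erase (0 : K × K)).card : R) = Fintype.card K ^ 2 - 1 := by
    rw [Finset.cast_card_erase_of_mem (Finset.mem_univ _), Finset.card_univ, Fintype.card_prod,
      Nat.cast_mul, sq]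
  rw [← filter_erase_zero_walshSum_eq hq, sq_mul_card_filter_eq_zero he
    fun c hc => h c (Finset.ne_of_mem_erase hc), Finset.sum_erase_eq_sub (Finset.mem_univ _),
    sum_walshSum_sq hψ hφ, walshSum_zero, hcard]
  ring

end WalshCounts

theorem finrank_zmod_eq_of_card_eq_pow {p m : ℕ} [Fact p.Prime] {K : Type*} [Field K]
    [Algebra (ZMod p) K] [Finite K] (hK : Nat.card K = p ^ m) :
    Module.finrank (ZMod p) K = m := by
  have hcard := Module.natCard_eq_pow_finrank (K := ZMod p) (V := K)
  rw [hK, Nat.card_zmod] at hcard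
  exact (Nat.pow_right_injective (Fact.out : p.Prime).two_le hcard).symm

theorem odd_trace_mul_add_mul {F K : Type*} [Field F] [Field K] [Algebra F K] {φ : K → K}
    (hφ : Function.Odd φ) (c : K × K) :
    Function.Odd fun x => Algebra.trace F K (c.1 * x + c.2 * φ x) := fun x => by
  beta_reduce
  rw [hφ, mul_neg, mul_neg, ← neg_add, map_neg]

theorem map_zero_of_odd {F X V : Type*} [Field F] [NegZeroClass X] [AddCommGroup V] [Module F V]
    (h2 : (2 : F) ≠ 0) {φ : X → V} (hφ : Function.Odd φ) : φ 0 = 0 := by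
  have hneg : φ 0 = -φ 0 := by simpa using hφ 0
  have hsmul : (2 : F) • φ 0 = 0 := by rw [two_smul, ← eq_neg_iff_add_eq_zero, ← hneg]
  exact (smul_eq_zero.1 hsmul).resolve_left h2

section TernaryPowerMaps

variable {K : Type*} [Field K] [Fintype K] [Algebra (ZMod 3) K]

theorem walshSum_traceChar_of_odd {φ : K → K} (hφ : Function.Odd φ) (c : K × K) :
    walshSum (traceChar K (ZMod.stdAddChar (N := 3))) φ c = Fintype.card K - 3 *
      ((Finset.univ.filter fun x => Algebra.trace (ZMod 3) K (c.1 * x + c.2 * φ x) = 1).card : ℂ) :=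
  sum_stdAddChar_of_odd (odd_trace_mul_add_mul hφ c)

-- Since `v (k + 1) = 2` in the exponents, the substitutions `x = z ^ (k + 1)` and
-- `x = -z ^ (k + 1)`, which together run twice over `K`, turn `Tr (a x + b x ^ v)` into
-- `Tr (a z ^ (k + 1) + b z ^ 2)` and its negative.
theorem sum_twistedTraceForm_add_conj (hK : Fintype.card K % 4 = 3) {v k : ℕ} (hv : Odd v)
    (hvk : v * (k + 1) ≡ 2 [MOD Fintype.card K - 1]) {σ : K ≃ₐ[ZMod 3] K}
    (hσ : ∀ x, σ x = x ^ k) (c : K × K) :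
    (∑ z, ZMod.stdAddChar (twistedTraceForm σ c.1 c.2 z)) +
        conj (∑ z, ZMod.stdAddChar (twistedTraceForm σ c.1 c.2 z)) =
      2 * walshSum (traceChar K (ZMod.stdAddChar (N := 3))) (· ^ v) c := by
  have hpow (z : K) : (z ^ (k + 1)) ^ v = z ^ 2 := by
    rw [← pow_mul, mul_comm]
    exact pow_eq_pow_of_modEq_card_sub_one (mul_ne_zero hv.pos.ne' k.add_one_ne_zero)
      two_ne_zero hvk z
  rw [conj_sum_stdAddChar, walshSum,
    ← sum_comp_pow_add_sum_comp_neg_pow hK hv k.add_one_ne_zero hvk]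
  congr 1 <;> refine Finset.sum_congr rfl fun z _ => congrArg ZMod.stdAddChar ?_
  · rw [twistedTraceForm_apply, hσ, hpow]
    refine congrArg (Algebra.trace (ZMod 3) K) ?_
    ring
  · rw [twistedTraceForm_apply, hσ, hv.neg_pow, hpow, ← map_neg]
    refine congrArg (Algebra.trace (ZMod 3) K) ?_
    ring

theorem walshSum_pow_eq_zero_or_sq_eq {m v k : ℕ} (hm : Odd m) (hK : Fintype.card K = 3 ^ m)
    (hv : Odd v) (hvk : v * (k + 1) ≡ 2 [MOD 3 ^ m - 1]) {σ : K ≃ₐ[ZMod 3] K}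
    (hσ : ∀ x, σ x = x ^ k) (hfix : ∀ x, σ x = x → x ∈ Set.range (algebraMap (ZMod 3) K))
    {c : K × K} (hc : c ≠ 0) :
    walshSum (traceChar K (ZMod.stdAddChar (N := 3))) (· ^ v) c = 0 ∨
      walshSum (traceChar K (ZMod.stdAddChar (N := 3))) (· ^ v) c ^ 2 = 3 ^ (m + 1) := by
  obtain ⟨r, hr, hnorm⟩ := exists_sum_twistedTraceForm_mul_conj (by decide)
    (ZMod.isPrimitive_stdAddChar 3) hfix hc
  obtain ⟨d, hd⟩ := exists_four_mul_sum_mul_conj (twistedTraceForm σ c.1 c.2)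
  rw [hnorm, sum_twistedTraceForm_add_conj (hK ▸ pow_mod_four_of_odd rfl hm) hv (hK ▸ hvk) hσ c,
    hK, ZMod.card] at hd
  obtain ⟨t, ht⟩ : ∃ t : ℤ, walshSum (traceChar K (ZMod.stdAddChar (N := 3))) (· ^ v) c = t := by
    rw [walshSum_traceChar_of_odd (φ := (· ^ v)) fun x : K => hv.neg_pow x]
    exact ⟨Fintype.card K - 3 * _, by push_cast; rfl⟩
  rw [ht] at hd ⊢
  have hdioph : 4 * t ^ 2 + 3 * d ^ 2 = 4 * 3 ^ (m + r) := by
    have : (4 * t ^ 2 + 3 * d ^ 2 : ℂ) = 4 * 3 ^ (m + r) := by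
      push_cast at hd
      linear_combination -hd
    exact_mod_cast this
  exact_mod_cast eq_zero_or_sq_eq_three_pow_succ hm hr hdioph

theorem hasThreeValuedWalshSum_pow {t h v : ℕ} (hK : Fintype.card K = 3 ^ (2 * t + 1))
    (hcop : h.Coprime (2 * t + 1)) (hv : Odd v)
    (hvh : v * (3 ^ h + 1) ≡ 2 [MOD 3 ^ (2 * t + 1) - 1]) :
    HasThreeValuedWalshSum (traceChar K (ZMod.stdAddChar (N := 3))) (· ^ v)
      (3 * (3 ^ t : ℕ)) := by
  intro c hc
  have hcop' : h.Coprime (Module.finrank (ZMod 3) K) := by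
    rwa [finrank_zmod_eq_of_card_eq_pow (hK ▸ Nat.card_eq_fintype_card)]
  refine (walshSum_pow_eq_zero_or_sq_eq (odd_two_mul_add_one t) hK hv hvh
    (σ := FiniteField.frobeniusAlgEquivOfAlgebraic (ZMod 3) K ^ h) (fun x => ?_)
    (fun x => mem_range_algebraMap_of_frobenius_pow_eq hcop') hc).imp_right fun hsq => ?_
  · rw [AlgEquiv.coe_pow, FiniteField.coe_frobeniusAlgEquivOfAlgebraic_iterate, ZMod.card]
  · rw [← sq_eq_sq_iff_eq_or_eq_neg, hsq]
    push_cast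
    ring

end TernaryPowerMaps

section Codes

theorem weightCount_zero {F : Type*} [Field F] [DecidableEq F] {n : ℕ}
    (C : Submodule F (Fin n → F)) : weightCount C 0 = 1 := by
  refine Set.ncard_eq_one.2 ⟨0, Set.ext fun c => ?_⟩
  simp only [Set.mem_ofPred_eq, hammingNorm_eq_zero, Set.mem_singleton_iff]
  exact and_iff_right_of_imp fun h => h ▸ C.zero_mem

theorem weightCount_range {F V : Type*} [Field F] [DecidableEq F] [AddCommGroup V] [Module F V]
    {n : ℕ} {L : V →ₗ[F] Fin n → F} (hL : Function.Injective L) (w : ℕ) :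
    weightCount (LinearMap.range L) w = {x | hammingNorm (L x) = w}.ncard := by
  rw [← Set.ncard_image_of_injective _ hL, weightCount]
  congr 1
  ext c
  constructor
  · rintro ⟨⟨x, rfl⟩, hw⟩
    exact ⟨x, hw, rfl⟩
  · rintro ⟨x, hw, rfl⟩
    exact ⟨⟨x, rfl⟩, hw⟩

theorem pow_finRotate {M : Type*} [Monoid M] {n : ℕ} {x : M} (hx : x ^ n = 1) (i : Fin n) :
    x ^ (finRotate n i : ℕ) = x ^ ((i : ℕ) + 1) := by
  rcases n with - | n
  · exact i.elim0
  rcases eq_or_ne i (Fin.last n) with rfl | hi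
  · rw [finRotate_last, Fin.val_last, hx, Fin.val_zero, pow_zero]
  · rw [coe_finRotate_of_ne_last hi]

theorem mul_inv_mul_pow_finRotate {L : Type*} [Field L] {n : ℕ} {g : L} (hg : g ^ n = 1) (a : L)
    (i : Fin n) : a * g⁻¹ * g ^ (finRotate n i : ℕ) = a * g ^ (i : ℕ) := by
  have hg0 : g ≠ 0 := by
    rintro rfl
    exact zero_ne_one ((zero_pow i.pos.ne').symm.trans hg)
  rw [pow_finRotate hg, pow_succ', mul_assoc, inv_mul_cancel_left₀ hg0]

theorem isCyclicCode_cyclicCode (u v : ℕ) {p m : ℕ} [Fact p.Prime] {K : Type*} [Field K]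
    [Algebra (ZMod p) K] {α : Kˣ} (hα : α ^ (p ^ m - 1) = 1) :
    IsCyclicCode (cyclicCode u v p m α) := by
  have hgen (u : ℕ) :
      IntermediateField.AdjoinSimple.gen (ZMod p) ((α : K) ^ u) ^ (p ^ m - 1) = 1 := by
    refine Subtype.ext ?_
    rw [SubmonoidClass.coe_pow, IntermediateField.AdjoinSimple.coe_gen, ← pow_mul, mul_comm,
      pow_mul, ← Units.val_pow_eq_pow_val, hα, Units.val_one, one_pow, OneMemClass.coe_one]
  rintro c ⟨⟨a, b⟩, rfl⟩
  refine ⟨(a * (IntermediateField.AdjoinSimple.gen (ZMod p) ((α : K) ^ u))⁻¹,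
    b * (IntermediateField.AdjoinSimple.gen (ZMod p) ((α : K) ^ v))⁻¹), funext fun i => ?_⟩
  obtain ⟨j, rfl⟩ := (finRotate _).surjective i
  simp only [Equiv.symm_apply_apply]
  exact congrArg₂ (fun x y : ZMod p => x + y)
    (congrArg (Algebra.trace (ZMod p) _) (mul_inv_mul_pow_finRotate (hgen u) a j))
    (congrArg (Algebra.trace (ZMod p) _) (mul_inv_mul_pow_finRotate (hgen v) b j))

theorem trace_of_eq_top {F K : Type*} [Field F] [Field K] [Algebra F K] {L : IntermediateField F K}
    (hL : L = ⊤) (x : L) : Algebra.trace F L x = Algebra.trace F K (x : K) := by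
  subst hL
  exact (Algebra.trace_eq_of_algEquiv IntermediateField.topEquiv x).symm

/-- The word of the values of `x ↦ Tr (a x + b φ(x))` at the points `x = α ^ i`, `i < n`, as a
linear function of `(a, b)`. -/
noncomputable def traceWord (F : Type*) {K : Type*} [Field F] [Field K] [Algebra F K] (φ : K → K)
    (n : ℕ) (α : K) : K × K →ₗ[F] Fin n → F :=
  LinearMap.pi fun i => Algebra.trace F K ∘ₗ
    LinearMap.coprod (LinearMap.mulRight F (α ^ (i : ℕ))) (LinearMap.mulRight F (φ (α ^ (i : ℕ))))

theorem traceWord_apply {F K : Type*} [Field F] [Field K] [Algebra F K] (φ : K → K) (n : ℕ)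
    (α : K) (c : K × K) (i : Fin n) :
    traceWord F φ n α c i = Algebra.trace F K (c.1 * α ^ (i : ℕ) + c.2 * φ (α ^ (i : ℕ))) := rfl

theorem adjoin_pow_eq_top {p m u : ℕ} [Fact p.Prime] (hm : 0 < m) {K : Type*} [Field K]
    [Algebra (ZMod p) K] (hK : Nat.card K = p ^ m) {α : Kˣ} (hα : ∀ x, x ∈ Subgroup.zpowers α)
    (hu : u.Coprime (p ^ m - 1)) : (ZMod p)⟮(α : K) ^ u⟯ = ⊤ := by
  have hp : p.Prime := Fact.out
  have : Finite K := Nat.finite_of_card_ne_zero (hK ▸ pow_ne_zero m hp.ne_zero)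
  refine IntermediateField.eq_of_le_of_finrank_eq le_top ?_
  rw [finrank_adjoin_pow p m u hK hm α hα, ncard_cyclotomicCoset_of_coprime hp.two_le hm.ne' hu,
    IntermediateField.finrank_top', finrank_zmod_eq_of_card_eq_pow hK]

theorem cyclicCode_one_eq_range_traceWord {p m v : ℕ} [Fact p.Prime] (hm : 0 < m) {K : Type*}
    [Field K] [Algebra (ZMod p) K] (hK : Nat.card K = p ^ m) {α : Kˣ}
    (hα : ∀ x, x ∈ Subgroup.zpowers α) (hv : v.Coprime (p ^ m - 1)) :
    cyclicCode 1 v p m α = LinearMap.range (traceWord (ZMod p) (· ^ v) (p ^ m - 1) (α : K)) := by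
  have h1_top := adjoin_pow_eq_top hm hK hα (Nat.coprime_one_left _)
  have hv_top := adjoin_pow_eq_top hm hK hα hv
  have hword (c) : codewordMap 1 v p m α c =
      traceWord (ZMod p) (· ^ v) (p ^ m - 1) (α : K) ((c.1 : K), (c.2 : K)) := by
    funext i
    simp [codewordMap, traceWord_apply, trace_of_eq_top h1_top, trace_of_eq_top hv_top,
      pow_right_comm]
  refine le_antisymm ?_ ?_
  · rintro _ ⟨c, rfl⟩
    exact ⟨_, (hword c).symm⟩
  · rintro _ ⟨c, rfl⟩
    exact ⟨(⟨c.1, h1_top ▸ IntermediateField.mem_top⟩,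
      ⟨c.2, hv_top ▸ IntermediateField.mem_top⟩), hword _⟩

theorem hammingNorm_traceWord {F K : Type*} [Field F] [DecidableEq F] [Field K] [Fintype K]
    [Algebra F K] {φ : K → K} (hφ : φ 0 = 0) {α : Kˣ} (hα : ∀ x, x ∈ Subgroup.zpowers α) {n : ℕ}
    (hn : orderOf α = n) (c : K × K) :
    hammingNorm (traceWord F φ n (α : K) c) =
      (Finset.univ.filter fun x => Algebra.trace F K (c.1 * x + c.2 * φ x) ≠ 0).card := by
  classical
  refine Finset.card_bij (fun i _ => (α : K) ^ (i : ℕ)) (fun i hi => ?_) (fun i _ j _ hij => ?_)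
    fun x hx => ?_
  · simpa [traceWord_apply] using hi
  · refine Fin.ext
      (pow_injOn_Iio_orderOf (i.2.trans_eq hn.symm) (j.2.trans_eq hn.symm) (Units.ext ?_))
    simpa using hij
  · have hx0 : x ≠ 0 := by
      rintro rfl
      simp [hφ] at hx
    lift x to Kˣ using isUnit_iff_ne_zero.2 hx0
    obtain ⟨i, hi, rfl⟩ := (mem_zpowers_iff_mem_range_orderOf.trans Finset.mem_image).1 (hα x)
    exact ⟨⟨i, by simpa [hn] using hi⟩, by simpa [traceWord_apply] using hx, by simp⟩

end Codes

theorem isPrimitive_traceChar_stdAddChar {K : Type*} [Field K] [Finite K] [Algebra (ZMod 3) K] :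
    (traceChar K (ZMod.stdAddChar (N := 3))).IsPrimitive :=
  isPrimitive_traceChar stdAddChar_three_ne_one

section TernaryWeights

variable {K : Type*} [Field K] [Fintype K] [Algebra (ZMod 3) K] {φ : K → K} {α : Kˣ} {n : ℕ}

theorem three_mul_hammingNorm_traceWord (hφ : Function.Odd φ)
    (hα : ∀ x, x ∈ Subgroup.zpowers α) (hn : orderOf α = n) (c : K × K) :
    3 * (hammingNorm (traceWord (ZMod 3) φ n (α : K) c) : ℂ) =
      2 * (Fintype.card K - walshSum (traceChar K (ZMod.stdAddChar (N := 3))) φ c) := by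
  have hφ0 : φ 0 = 0 := map_zero_of_odd (F := ZMod 3) (by decide) hφ
  rw [hammingNorm_traceWord hφ0 hα hn, card_filter_ne_zero_of_odd (odd_trace_mul_add_mul hφ c),
    walshSum_traceChar_of_odd hφ]
  push_cast
  ring

theorem hammingNorm_traceWord_eq_iff (hφ : Function.Odd φ)
    (hα : ∀ x, x ∈ Subgroup.zpowers α) (hn : orderOf α = n) {w : ℕ} {d : ℂ}
    (hwd : 3 * w = 2 * (Fintype.card K - d)) (c : K × K) :
    hammingNorm (traceWord (ZMod 3) φ n (α : K) c) = w ↔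
      walshSum (traceChar K (ZMod.stdAddChar (N := 3))) φ c = d := by
  have h := three_mul_hammingNorm_traceWord hφ hα hn c
  rw [← Nat.cast_inj (R := ℂ)]
  constructor <;> intro hc
  · linear_combination (h - hwd - 3 * hc) / 2
  · linear_combination (h - hwd - 2 * hc) / 3

theorem weightCount_range_traceWord (hφ : Function.Odd φ)
    (hα : ∀ x, x ∈ Subgroup.zpowers α) (hn : orderOf α = n)
    (hinj : Function.Injective (traceWord (ZMod 3) φ n (α : K)))
    {w : ℕ} {d : ℂ} (hwd : 3 * w = 2 * (Fintype.card K - d)) :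
    weightCount (LinearMap.range (traceWord (ZMod 3) φ n (α : K))) w =
      (Finset.univ.filter fun c =>
        walshSum (traceChar K (ZMod.stdAddChar (N := 3))) φ c = d).card := by
  rw [weightCount_range hinj, ← Set.ncard_coe_finset]
  congr 1
  ext c
  simp [hammingNorm_traceWord_eq_iff hφ hα hn hwd]

theorem traceWord_injective (hφ : Function.Odd φ)
    (hα : ∀ x, x ∈ Subgroup.zpowers α) (hn : orderOf α = n) {e : ℂ}
    (h : HasThreeValuedWalshSum (traceChar K (ZMod.stdAddChar (N := 3))) φ e)
    (he : e ≠ Fintype.card K) (he' : -e ≠ Fintype.card K) :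
    Function.Injective (traceWord (ZMod 3) φ n (α : K)) := by
  refine (injective_iff_map_eq_zero _).2 fun c hc => ?_
  by_contra hne
  have hcard : walshSum (traceChar K (ZMod.stdAddChar (N := 3))) φ c = Fintype.card K :=
    (hammingNorm_traceWord_eq_iff hφ hα hn (w := 0) (by simp) c).1 (by rw [hc, hammingNorm_zero])
  rcases h c hne with h | h | h <;> rw [hcard] at h
  · exact Nat.cast_ne_zero.2 Fintype.card_ne_zero h
  · exact he h.symm
  · exact he' h.symm

theorem traceWord_injective_of_card_eq {r : ℕ} (hφ : Function.Odd φ)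
    (hα : ∀ x, x ∈ Subgroup.zpowers α) (hn : orderOf α = n) (hr : 1 < r)
    (hK : Fintype.card K = 3 * r ^ 2)
    (h : HasThreeValuedWalshSum (traceChar K (ZMod.stdAddChar (N := 3))) φ (3 * r)) :
    Function.Injective (traceWord (ZMod 3) φ n (α : K)) := by
  refine traceWord_injective hφ hα hn h ?_ ?_
  · intro heq
    have : 3 * r = Fintype.card K := by exact_mod_cast heq
    nlinarith
  · intro heq
    have : (-(3 * r) : ℤ) = Fintype.card K := by exact_mod_cast heq
    lia

variable {s : ℤ} {w : ℕ}

theorem weightCount_range_traceWord_two_mul_sq_sub (hφ : Function.Odd φ)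
    (hα : ∀ x, x ∈ Subgroup.zpowers α) (hn : orderOf α = n)
    (hinj : Function.Injective (traceWord (ZMod 3) φ n (α : K)))
    (hs : s ≠ 0) (hs1 : s ≠ 1) (hK : (Fintype.card K : ℤ) = 3 * s ^ 2)
    (h : HasThreeValuedWalshSum (traceChar K (ZMod.stdAddChar (N := 3))) φ (3 * s))
    (hw : (w : ℤ) = 2 * (s ^ 2 - s)) :
    (weightCount (LinearMap.range (traceWord (ZMod 3) φ n (α : K))) w : ℚ) =
      1 / 2 * (3 * s ^ 2 - 1) * (s ^ 2 + s) := by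
  classical
  have hKC : (Fintype.card K : ℂ) = 3 * s ^ 2 := by exact_mod_cast hK
  have hwC : (w : ℂ) = 2 * (s ^ 2 - s) := by exact_mod_cast hw
  have hs0 : (s : ℂ) ≠ 0 := Int.cast_ne_zero.2 hs
  have hne : (Fintype.card K : ℂ) ≠ 3 * s := by
    rw [hKC, Ne, mul_right_inj' three_ne_zero, sq, mul_eq_left₀ hs0]
    exact_mod_cast hs1
  have hcount := two_mul_sq_mul_card_walshSum_eq isPrimitive_traceChar_stdAddChar hφ
    (map_zero_of_odd (F := ZMod 3) (by decide) hφ) (mul_ne_zero three_ne_zero hs0) hne h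
  rw [← weightCount_range_traceWord hφ hα hn hinj (w := w) (by rw [hKC, hwC]; ring), hKC] at hcount
  refine Rat.cast_injective (α := ℂ) ?_
  push_cast
  refine mul_left_cancel₀ (pow_ne_zero 2 hs0) ?_
  linear_combination hcount / 18

theorem weightCount_range_traceWord_two_mul_sq (hφ : Function.Odd φ)
    (hα : ∀ x, x ∈ Subgroup.zpowers α) (hn : orderOf α = n)
    (hinj : Function.Injective (traceWord (ZMod 3) φ n (α : K)))
    (hs : s ≠ 0) (hK : (Fintype.card K : ℤ) = 3 * s ^ 2)
    (h : HasThreeValuedWalshSum (traceChar K (ZMod.stdAddChar (N := 3))) φ (3 * s))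
    (hw : (w : ℤ) = 2 * s ^ 2) :
    (weightCount (LinearMap.range (traceWord (ZMod 3) φ n (α : K))) w : ℚ) =
      (3 * s ^ 2 - 1) * (3 * s ^ 2 - s ^ 2 + 1) := by
  classical
  have hKC : (Fintype.card K : ℂ) = 3 * s ^ 2 := by exact_mod_cast hK
  have hwC : (w : ℂ) = 2 * s ^ 2 := by exact_mod_cast hw
  have hs0 : (s : ℂ) ≠ 0 := Int.cast_ne_zero.2 hs
  have hcount := sq_mul_card_walshSum_eq_zero isPrimitive_traceChar_stdAddChar hφ
    (mul_ne_zero three_ne_zero hs0) h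
  rw [← weightCount_range_traceWord hφ hα hn hinj (w := w) (by rw [hKC, hwC]; ring), hKC] at hcount
  refine Rat.cast_injective (α := ℂ) ?_
  push_cast
  refine mul_left_cancel₀ (pow_ne_zero 2 hs0) ?_
  linear_combination hcount / 9

theorem weightCount_range_traceWord_eq_zero (hφ : Function.Odd φ)
    (hα : ∀ x, x ∈ Subgroup.zpowers α) (hn : orderOf α = n) (hK : (Fintype.card K : ℤ) = 3 * s ^ 2)
    (h : HasThreeValuedWalshSum (traceChar K (ZMod.stdAddChar (N := 3))) φ (3 * s))
    (hw : w ≠ 0) (hw_sub : (w : ℤ) ≠ 2 * (s ^ 2 - s)) (hw_sq : (w : ℤ) ≠ 2 * s ^ 2)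
    (hw_add : (w : ℤ) ≠ 2 * (s ^ 2 + s)) :
    weightCount (LinearMap.range (traceWord (ZMod 3) φ n (α : K))) w = 0 := by
  refine (Set.ncard_eq_zero (Set.toFinite _)).2 (Set.eq_empty_iff_forall_notMem.2 ?_)
  rintro _ ⟨⟨c, rfl⟩, hcw⟩
  have hnorm := three_mul_hammingNorm_traceWord hφ hα hn c
  have hKC : (Fintype.card K : ℂ) = 3 * s ^ 2 := by exact_mod_cast hK
  rw [hcw, hKC] at hnorm
  have hc : c ≠ 0 := by
    rintro rfl
    exact hw (by rw [← hcw, map_zero, hammingNorm_zero])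
  rcases h c hc with hd | hd | hd <;> rw [hd] at hnorm
  · refine hw_sq (Int.cast_injective (α := ℂ) ?_)
    push_cast
    linear_combination hnorm / 3
  · refine hw_sub (Int.cast_injective (α := ℂ) ?_)
    push_cast
    linear_combination hnorm / 3
  · refine hw_add (Int.cast_injective (α := ℂ) ?_)
    push_cast
    linear_combination hnorm / 3

theorem weightDistribution_range_traceWord {r : ℕ} (hφ : Function.Odd φ)
    (hα : ∀ x, x ∈ Subgroup.zpowers α) (hn : orderOf α = n) (hr : 1 < r)
    (hK : Fintype.card K = 3 * r ^ 2)
    (h : HasThreeValuedWalshSum (traceChar K (ZMod.stdAddChar (N := 3))) φ (3 * r)) :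
    let C := LinearMap.range (traceWord (ZMod 3) φ n (α : K))
    (weightCount C (2 * (r ^ 2 - r)) : ℚ) = 1 / 2 * (3 * r ^ 2 - 1) * (r ^ 2 + r) ∧
    (weightCount C (2 * r ^ 2) : ℚ) = (3 * r ^ 2 - 1) * (3 * r ^ 2 - r ^ 2 + 1) ∧
    (weightCount C (2 * (r ^ 2 + r)) : ℚ) = 1 / 2 * (3 * r ^ 2 - 1) * (r ^ 2 - r) ∧
    ∀ w : ℕ, w ≠ 0 → w ≠ 2 * (r ^ 2 - r) → w ≠ 2 * r ^ 2 → w ≠ 2 * (r ^ 2 + r) →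
      weightCount C w = 0 := by
  have hinj := traceWord_injective_of_card_eq hφ hα hn hr hK h
  have hKs : (Fintype.card K : ℤ) = 3 * (r : ℤ) ^ 2 := by exact_mod_cast hK
  have hsub : ((2 * (r ^ 2 - r) : ℕ) : ℤ) = 2 * ((r : ℤ) ^ 2 - r) := by
    push_cast [Nat.le_self_pow two_ne_zero r]
    rfl
  refine ⟨?_, ?_, ?_, fun w hw hw_sub hw_sq hw_add => ?_⟩
  · exact_mod_cast weightCount_range_traceWord_two_mul_sq_sub hφ hα hn hinj (by lia) (by lia) hKs
      (by exact_mod_cast h) hsub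
  · exact_mod_cast weightCount_range_traceWord_two_mul_sq hφ hα hn hinj (by lia) hKs
      (by exact_mod_cast h) (by push_cast; rfl)
  · have := weightCount_range_traceWord_two_mul_sq_sub (s := -r) (w := 2 * (r ^ 2 + r)) hφ hα hn
      hinj (by lia) (by lia) (by rwa [neg_sq]) (by simpa using h.neg) (by push_cast; ring)
    simpa [← sub_eq_add_neg] using this
  · exact weightCount_range_traceWord_eq_zero hφ hα hn hKs (by exact_mod_cast h) hw
      (by rwa [← hsub, Ne, Nat.cast_inj]) (by exact_mod_cast hw_sq) (by exact_mod_cast hw_add)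

end TernaryWeights

theorem theorem5_general {m h v : ℕ} (hm : 3 ≤ m) (hodd : Odd m) {K : Type*} [Field K]
    [Algebra (ZMod 3) K] (hK : Nat.card K = 3 ^ m) {α : Kˣ} (hα : ∀ x : Kˣ, x ∈ Subgroup.zpowers α)
    (hcop : h.Coprime m) (hv : Odd v) (hvh : v * (3 ^ h + 1) ≡ 2 [MOD 3 ^ m - 1]) :
    Disjoint (cyclotomicCoset 3 (3 ^ m - 1) 1) (cyclotomicCoset 3 (3 ^ m - 1) v) ∧
    (cyclotomicCoset 3 (3 ^ m - 1) 1).ncard = m ∧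
    (cyclotomicCoset 3 (3 ^ m - 1) v).ncard = m ∧
    IsCyclicCode (cyclicCode 1 v 3 m α) ∧
    Module.finrank (ZMod 3) (cyclicCode 1 v 3 m α) = 2 * m ∧
    weightCount (cyclicCode 1 v 3 m α) 0 = 1 ∧
    (weightCount (cyclicCode 1 v 3 m α) (2 * (3 ^ (m - 1) - 3 ^ ((m - 1) / 2))) : ℚ) =
      1 / 2 * (3 ^ m - 1) * (3 ^ (m - 1) + 3 ^ ((m - 1) / 2)) ∧
    (weightCount (cyclicCode 1 v 3 m α) (2 * 3 ^ (m - 1)) : ℚ) =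
      (3 ^ m - 1) * (3 ^ m - 3 ^ (m - 1) + 1) ∧
    (weightCount (cyclicCode 1 v 3 m α) (2 * (3 ^ (m - 1) + 3 ^ ((m - 1) / 2))) : ℚ) =
      1 / 2 * (3 ^ m - 1) * (3 ^ (m - 1) - 3 ^ ((m - 1) / 2)) ∧
    (∀ w : ℕ, w ≠ 0 → w ≠ 2 * (3 ^ (m - 1) - 3 ^ ((m - 1) / 2)) → w ≠ 2 * 3 ^ (m - 1) →
      w ≠ 2 * (3 ^ (m - 1) + 3 ^ ((m - 1) / 2)) →
      weightCount (cyclicCode 1 v 3 m α) w = 0) := by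
  have : Finite K := Nat.finite_of_card_ne_zero (hK ▸ pow_ne_zero m three_ne_zero)
  have : Fintype K := Fintype.ofFinite K
  have hvcop : v.Coprime (3 ^ m - 1) := coprime_of_odd_of_mul_modEq_two hv hvh
  have hα_ord : orderOf α = 3 ^ m - 1 := by
    rw [orderOf_eq_card_of_forall_mem_zpowers hα, Nat.card_units, hK]
  have hm_dvd : ¬ m ∣ h := fun hdvd => by
    have := Nat.eq_one_of_dvd_coprimes hcop hdvd dvd_rfl
    lia
  obtain ⟨t, rfl⟩ := hodd
  have hr : 1 < 3 ^ t := Nat.one_lt_pow (by lia) (by lia)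
  have hKr : Fintype.card K = 3 * (3 ^ t) ^ 2 := by
    rw [← Nat.card_eq_fintype_card, hK, ← pow_mul', pow_succ']
  have hφ : Function.Odd fun x : K => x ^ v := fun x => hv.neg_pow x
  have hwalsh := hasThreeValuedWalshSum_pow (Nat.card_eq_fintype_card.symm.trans hK) hcop hv hvh
  rw [Nat.add_sub_cancel, Nat.mul_div_cancel_left t two_pos]
  refine ⟨disjoint_cyclotomicCoset_one le_rfl (by lia) hm_dvd hvh,
    ncard_cyclotomicCoset_of_coprime (by lia) (by lia) (Nat.coprime_one_left _),
    ncard_cyclotomicCoset_of_coprime (by lia) (by lia) hvcop,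
    isCyclicCode_cyclicCode 1 v (hα_ord ▸ pow_orderOf_eq_one α), ?_, weightCount_zero _, ?_⟩ <;>
    rw [cyclicCode_one_eq_range_traceWord (by lia) hK hα hvcop]
  · rw [LinearMap.finrank_range_of_inj (traceWord_injective_of_card_eq hφ hα hα_ord hr hKr hwalsh),
      Module.finrank_prod, finrank_zmod_eq_of_card_eq_pow hK, ← two_mul]
  · simpa only [← pow_mul', ← pow_succ', Nat.cast_pow, Nat.cast_ofNat] using
      weightDistribution_range_traceWord hφ hα hα_ord hr hKr hwalsh

theorem theorem5 (m : ℕ) (hm : 3 ≤ m) (hodd : Odd m)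
    (K : Type*) [Field K] [Algebra (ZMod 3) K] (hK : Nat.card K = 3 ^ m)
    (α : Kˣ) (hα : ∀ x : Kˣ, x ∈ Subgroup.zpowers α)
    (v : ℕ)
    (hv : (∃ h : ℕ, 0 < h ∧ h ∣ m + 1 ∧ Even ((m + 1) / h) ∧
            v = (3 ^ (m + 1) - 1) / (3 ^ h + 1) + (3 ^ m - 1) / 2) ∨
          (m % 8 = 7 ∧
            v = (3 ^ ((m + 1) / 8) - 1) * (3 ^ ((m + 1) / 4) + 1) * (3 ^ ((m + 1) / 2) + 1)
                  + (3 ^ m - 1) / 2) ∨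
          (m % 4 = 3 ∧
            v = (3 ^ ((m + 1) / 4) - 1) * (3 ^ ((m + 1) / 2) + 1) + (3 ^ m - 1) / 2)) :
    -- the two cyclotomic cosets are disjoint and have size `m`
    Disjoint (cyclotomicCoset 3 (3 ^ m - 1) 1) (cyclotomicCoset 3 (3 ^ m - 1) v) ∧
    (cyclotomicCoset 3 (3 ^ m - 1) 1).ncard = m ∧
    (cyclotomicCoset 3 (3 ^ m - 1) v).ncard = m ∧
    -- a cyclic code of length `3 ^ m - 1` and dimension `2 m`
    IsCyclicCode (cyclicCode 1 v 3 m α) ∧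
    Module.finrank (ZMod 3) (cyclicCode 1 v 3 m α) = 2 * m ∧
    -- its weight distribution
    weightCount (cyclicCode 1 v 3 m α) 0 = 1 ∧
    (weightCount (cyclicCode 1 v 3 m α) (2 * (3 ^ (m - 1) - 3 ^ ((m - 1) / 2))) : ℚ) =
      1 / 2 * (3 ^ m - 1) * (3 ^ (m - 1) + 3 ^ ((m - 1) / 2)) ∧
    (weightCount (cyclicCode 1 v 3 m α) (2 * 3 ^ (m - 1)) : ℚ) =
      (3 ^ m - 1) * (3 ^ m - 3 ^ (m - 1) + 1) ∧
    (weightCount (cyclicCode 1 v 3 m α) (2 * (3 ^ (m - 1) + 3 ^ ((m - 1) / 2))) : ℚ) =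
      1 / 2 * (3 ^ m - 1) * (3 ^ (m - 1) - 3 ^ ((m - 1) / 2)) ∧
    (∀ w : ℕ, w ≠ 0 → w ≠ 2 * (3 ^ (m - 1) - 3 ^ ((m - 1) / 2)) → w ≠ 2 * 3 ^ (m - 1) →
      w ≠ 2 * (3 ^ (m - 1) + 3 ^ ((m - 1) / 2)) →
      weightCount (cyclicCode 1 v 3 m α) w = 0) := by
  obtain ⟨h, hcop, hv_odd, hvh⟩ := exists_coprime_odd_modEq_two_of_families hodd hv
  exact theorem5_general hm hodd hK hα hcop hv_odd hvh
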